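/- **Setting.** Let $\mathcal X$ be a measurable space, $c\ge 1$ a number of classes, and let a dataset be a finite tuple $S=(x_i,y_i)_{i\in[n]}$ ($n\ge 0$ arbitrary) with $x_i\in\mathcal X$ and $y_i\in\{0,1\}^c$ one-hot. Two datasets are neighbouring if one arises from the other by deleting one record. Fix a kernel $\kappa:\mathcal X\times\mathcal X\to\mathbb R$ with $q\mapsto\kappa(x,q)$ measurable for every $x$, a threshold $\tau\in\mathbb R$ such that $\kappa(x,q)\ge\tau$ implies $\kappa(x,q)\ge 0$ (for instance $\kappa\ge 0$ or $\tau\ge 0$), noise scales $\sigma_1,\sigma_2>0$, an individual budget $B\ge 0$, and a floor $m\ge 0$ for the noisy neighbour count. **The Ind-KNN algorithm.** Set $z_i=B$ for all $i\in[n]$. For $t=1,\dots,T$: 1. A query $q_t\in\mathcal X$ is drawn by a query generator: a Markov kernel applied to everything released so far, $(q_s,K_s,a_s)_{s<t}$ (a fixed sequence $q_1,\dots,q_T$ is a special case). 2. The active set is $A_t=\{i: z_i\ge \frac1{2\sigma_1^2}\}$. 3. Release $K_t=\sum_{i\in A_t}\mathbb I[\kappa(x_i,q_t)\ge\tau]+\mathcal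 N(0,\sigma_1^2)$, and put $\bar K_t=\max(K_t,m)$. 4. For each $i\in A_t$: replace $z_i$ by $z_i-\frac1{2\sigma_1^2}\mathbb I[\kappa(x_i,q_t)\ge\tau]$; then let $$f_t(x_i,y_i)=\min\big(\kappa(x_i,q_t)\,y_i\,\mathbb I[\kappa(x_i,q_t)\ge\tau],\ \sigma_2\sqrt{2\bar K_t z_i}\,\mathbf 1_c\big)$$ (entrywise minimum); then replace $z_i$ by $z_i-\frac{\|f_t(x_i,y_i)\|_2^2}{2\sigma_2^2\bar K_t}$. 5. Release $a_t=\arg\max_{j\in[c]}\big(\sum_{i\in A_t}f_t(x_i,y_i)+\mathcal N(\mathbf 0,\sigma_2^2\bar K_t\mathbf I_c)\big)_j$, ties going to the smallest index. The algorithm returns $(a_1,\dots,a_T)$. If $\bar K_t=0$ (possible only for $m=0$), the Gaussian in step 5 is the point mass at $\mathbf 0$ and, since then $f_t=\mathbf 0$, the second subtraction in step 4 is $0$. **Rényi differential privacy.** For probability measures $\mu,\nu$ let $D_\alpha(\mu\|\nu)=\frac1{\alpha-1}\log\int\big(\frac{d\mu}{d\nu}\big)^\alpha d\nu$ for $\alpha>1$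 (and $+\infty$ if $\mu\not\ll\nu$), and let $D_1$ be the Kullback–Leibler divergence. A randomized mechanism $\mathcal A$ is $(\alpha,\varepsilon)$-RDP if $D_\alpha(\mathcal A(S)\|\mathcal A(S'))\le\varepsilon$ for all neighbouring $S,S'$ (in both orders). **Theorem 3.1.** For every number of rounds $T\ge 0$, every query generator and every $\alpha\ge 1$, the Ind-KNN algorithm satisfies $(\alpha,B\alpha)$-RDP. This holds for the returned sequence $(a_1,\dots,a_T)$, and also for the full released transcript $(q_t,K_t,a_t)_{t=1}^T$. -/

import Mathlib

open MeasureTheory ProbabilityTheory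

noncomputable section

/-! ### Renyi divergence and Renyi differential privacy -/

/-- The Renyi divergence `D_α(μ ‖ ν)` of order `α ≥ 1` with values in `[-∞, ∞]`: for `α ≠ 1` it is
`(α - 1)⁻¹ log ∫ (dμ/dν)^α dν` (and `∞` if `μ` is not absolutely continuous with respect to `ν`);
at `α = 1` it is the Kullback-Leibler divergence, the usual continuous extension. -/
def renyiDiv {Ω : Type*} [MeasurableSpace Ω] (α : ℝ) (μ ν : Measure Ω) : EReal :=
  open Classical in
  if α = 1 then ((InformationTheory.klDiv μ ν : ENNReal) : EReal)
  else if μ ≪ ν then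
    (((α - 1)⁻¹ : ℝ) : EReal) * ENNReal.log (∫⁻ ω, (μ.rnDeriv ν ω) ^ α ∂ν)
  else ⊤

/-- Two datasets (finite tuples of records) are neighbouring if one of them arises from the other
by deleting one record. -/
def Neighbouring {Z : Type*} (S S' : List Z) : Prop :=
  (∃ i, i < S.length ∧ S' = S.eraseIdx i) ∨ (∃ i, i < S'.length ∧ S = S'.eraseIdx i)

/-- `M`, which sends a dataset to the law of the output, is a randomized mechanism (all the laws are
probability measures) that is `(α, ε)`-Renyi differentially private. -/
def IsRDP {Z Ω : Type*} [MeasurableSpace Ω] (α ε : ℝ) (M : List Z → Measure Ω) : Prop :=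
  (∀ S, IsProbabilityMeasure (M S)) ∧
    ∀ S S', Neighbouring S S' → renyiDiv α (M S) (M S') ≤ (ε : EReal)

/-! ### The Ind-KNN algorithm -/

/-- The one-hot vector of the class `y`. -/
def oneHot {c : ℕ} (y : Fin c) : Fin c → ℝ := fun j => if j = y then 1 else 0

/-- The index of a largest entry of `v` (the smallest such index, if there are ties). -/
def argMax {c : ℕ} [NeZero c] (v : Fin c → ℝ) : Fin c :=
  open Classical in
  (Finset.univ.filter (fun j => ∀ k, v k ≤ v j)).min' (by
    obtain ⟨j, hj⟩ := Finite.exists_max v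
    exact ⟨j, by simpa using hj⟩)

/-- The public inputs of the algorithm. `floor` is the lower bound that is imposed on the noisy
neighbour count wherever it enters a variance, a square root or a denominator. -/
structure IndKNN (X : Type*) where
  /-- the kernel function (record first, query second) -/
  kappa : X → X → ℝ
  /-- the selection threshold -/
  tau : ℝ
  /-- the noise scale of the neighbour count -/
  sigma1 : ℝ
  /-- the noise scale of the label vote -/
  sigma2 : ℝ
  /-- the individual budget -/
  B : ℝ
  /-- the lower bound of the noisy neighbour count -/
  floor : ℝ

/-- What becomes public in one round: the query, the noisy neighbour count, the predicted label. -/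
abbrev Round (X : Type*) (c : ℕ) : Type _ := X × ℝ × Fin c

namespace IndKNN

variable {X : Type*} {c : ℕ}

/-- A record is selected for the query `q` if its kernel weight is at least the threshold;
this is the indicator of that event. -/
def selected (P : IndKNN X) (x q : X) : ℝ :=
  open Classical in if P.tau ≤ P.kappa x q then 1 else 0

/-- The noisy count as it is used after its release. -/
def clamp (P : IndKNN X) (K : ℝ) : ℝ := max K P.floor

/-- A record with remaining budget `z` is active if `z ≥ 1 / (2σ₁²)`. -/
def Active (P : IndKNN X) (z : ℝ) : Prop := 1 / (2 * P.sigma1 ^ 2) ≤ z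

/-- The remaining budget of an active record after the release of the noisy count. -/
def afterCount (P : IndKNN X) (q : X) (x : X) (z : ℝ) : ℝ :=
  z - 1 / (2 * P.sigma1 ^ 2) * P.selected x q

/-- The individual contribution of the record `(x, y)`, whose remaining budget after the release of
the noisy count `K` is `z`: the entrywise minimum of `κ(x, q) · y · 𝕀[κ(x, q) ≥ τ]` and
`σ₂ √(2 K z) · 𝟏`. -/
def contribution (P : IndKNN X) (q : X) (K : ℝ) (p : X × Fin c) (z : ℝ) : Fin c → ℝ :=
  fun j => min (P.kappa p.1 q * oneHot p.2 j * P.selected p.1 q)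
    (P.sigma2 * √(2 * P.clamp K * z))

/-- The remaining budget of an active record after the release of the label: the squared
Euclidean norm of the contribution, divided by `2 σ₂² K`, is subtracted. -/
def afterLabel (P : IndKNN X) (q : X) (K : ℝ) (p : X × Fin c) (z : ℝ) : ℝ :=
  z - (∑ j, P.contribution q K p z j ^ 2) / (2 * P.sigma2 ^ 2 * P.clamp K)

/-- The remaining budget of the record `p` at the beginning of round `t` (counted from `0`), given
what was made public in the rounds before. It starts at `B`, and in every round in which the record
is active it is lowered twice; inactive records are left alone. -/
def budget (P : IndKNN X) (p : X × Fin c) : (t : ℕ) → (Fin t → Round X c) → ℝ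
  | 0, _ => P.B
  | t + 1, h =>
    let z := budget P p t (Fin.init h)
    let q := (h (Fin.last t)).1
    let K := (h (Fin.last t)).2.1
    open Classical in
    if P.Active z then P.afterLabel q K p (P.afterCount q p.1 z) else z

/-- The number of active records that are selected for the query `q` in round `t`. -/
def count (P : IndKNN X) (S : List (X × Fin c)) {t : ℕ} (h : Fin t → Round X c) (q : X) : ℝ :=
  open Classical in
  (S.map fun p => if P.Active (P.budget p t h) then P.selected p.1 q else 0).sum

/-- The sum of the contributions of the active records in round `t`. -/
def votes (P : IndKNN X) (S : List (X × Fin c)) {t : ℕ} (h : Fin t → Round X c) (q : X) (K : ℝ) :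
    Fin c → ℝ :=
  open Classical in
  (S.map fun p => if P.Active (P.budget p t h) then
    P.contribution q K p (P.afterCount q p.1 (P.budget p t h)) else 0).sum

/-- The law of the noisy count: `count + N(0, σ₁²)`. -/
def countLaw (P : IndKNN X) (S : List (X × Fin c)) {t : ℕ} (h : Fin t → Round X c) (q : X) :
    Measure ℝ :=
  gaussianReal (P.count S h q) (P.sigma1 ^ 2).toNNReal

/-- The law of the label: the arg max of `votes + N(0, σ₂² K I)`. -/
def labelLaw [NeZero c] (P : IndKNN X) (S : List (X × Fin c)) {t : ℕ} (h : Fin t → Round X c)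
    (q : X) (K : ℝ) : Measure (Fin c) :=
  (Measure.pi fun j => gaussianReal (P.votes S h q K j)
    (P.sigma2 ^ 2 * P.clamp K).toNNReal).map argMax

/-- The law of the public transcript of the first `T` rounds on the dataset `S`: in each round the
query generator `Q` draws a query from what is public so far, then the noisy count is released,
then the label. -/
def transcript [NeZero c] [MeasurableSpace X] (P : IndKNN X)
    (Q : (t : ℕ) → Kernel (Fin t → Round X c) X) (S : List (X × Fin c)) :
    (T : ℕ) → Measure (Fin T → Round X c)
  | 0 => Measure.dirac Fin.elim0
  | t + 1 =>
    (transcript P Q S t).bind fun h =>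
      (Q t h).bind fun q =>
        (P.countLaw S h q).bind fun K =>
          (P.labelLaw S h q K).map fun a =>
            (Fin.snoc h (q, K, a) : Fin (t + 1) → Round X c)

/-- The law of the sequence of predicted labels `(a₁, …, a_T)` that the algorithm returns. -/
def output [NeZero c] [MeasurableSpace X] (P : IndKNN X)
    (Q : (t : ℕ) → Kernel (Fin t → Round X c) X) (T : ℕ) (S : List (X × Fin c)) :
    Measure (Fin T → Fin c) :=
  (P.transcript Q S T).map fun h t => (h t).2.2

end IndKNN

end

/-! Neighbouring datasets differ in one record `p`. Given the public past, `p` shifts the mean of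
the count and one coordinate of the votes. A Gaussian of variance `v` shifted by `d` costs `r * d ^
2 / (2 * v)` at Rényi order `r`, and the algorithm subtracts exactly `d ^ 2 / (2 * v)` from the
budget of `p`. That budget never becomes negative: the activity threshold covers the price of a
count, the clipping that of a vote. Hence at most `B` is spent along every transcript, although the
individual costs are adaptive and random.

To turn this pathwise bound into a divergence bound, Rényi bounds are stated dually, as Hölder
inequalities between the transcript laws `μ` and `ν`. The remaining budget of `p` depends only on
`p` and the transcript, so `w = exp ((r - 1) * budget)` is a function of the transcript. The
invariant, proved by induction on the rounds, is `∫ f w dμ ≤ exp ((r - 1) * B) * (∫ f ^ r' dν) ^ (1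
/ r')`, with `r'` conjugate to `r` (`weightedHolderDominated_transcript`): each release loses the
factor by which `w` drops (`WeightedHolderDominated.bind`). Finally `1 ≤ w` is discarded, and the
converse of Hölder's inequality (`lintegral_rnDeriv_rpow_le`) bounds the `r`-th moment of `dμ/dν` by
`exp (r * (r - 1) * B)`. Order 1 follows by letting `r` decrease to 1. -/

/-- The dual form of a bound on the Renyi divergence: the conclusion of Hölder's inequality for
the integral of `f` against `μ`, with the constant `C` in place of the norm of `dμ/dν`. -/
def HolderDominated {Ω : Type*} [MeasurableSpace Ω] (q : ℝ) (C : ENNReal) (μ ν : Measure Ω) :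
    Prop :=
  ∀ f : Ω → ENNReal, Measurable f → ∫⁻ ω, f ω ∂μ ≤ C * (∫⁻ ω, f ω ^ q ∂ν) ^ (1 / q)

/-! ### Calculus of dual Rényi bounds -/

namespace HolderDominated

variable {Ω Ω' : Type*} [MeasurableSpace Ω] [MeasurableSpace Ω'] {p q : ℝ} {C : ENNReal}

/-- Hölder against the constant 1. It covers public randomness, such as the query generator. -/
lemma refl (hpq : p.HolderConjugate q) (μ : Measure Ω) [IsProbabilityMeasure μ] :
    HolderDominated q 1 μ μ := by
  intro f hf
  have h := ENNReal.lintegral_mul_le_Lp_mul_Lq μ hpq (f := 1) (g := f) measurable_one.aemeasurable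
    hf.aemeasurable
  simpa using h

lemma map {μ ν : Measure Ω} (h : HolderDominated q C μ ν) {g : Ω → Ω'} (hg : Measurable g) :
    HolderDominated q C (μ.map g) (ν.map g) := by
  intro f hf
  rw [lintegral_map hf hg, lintegral_map (hf.pow_const q) hg]
  exact h _ (hf.comp hg)

/-- The hypothesis is applied on each slice; `refl` for `ρ` then moves the exponent `1 / q` outside
the outer integral. -/
lemma prod (hpq : p.HolderConjugate q) {μ ν : Measure Ω} [SFinite μ] [SFinite ν]
    (h : HolderDominated q C μ ν) (ρ : Measure Ω') [IsProbabilityMeasure ρ] :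
    HolderDominated q C (μ.prod ρ) (ν.prod ρ) := by
  intro f hf
  have hq : q ≠ 0 := hpq.symm.ne_zero
  rw [lintegral_prod_symm _ hf.aemeasurable, lintegral_prod_symm _ (hf.pow_const q).aemeasurable]
  have hm : Measurable fun y => (∫⁻ x, f (x, y) ^ q ∂ν) ^ (1 / q) :=
    ((hf.pow_const q).lintegral_prod_left').pow_const _
  calc ∫⁻ y, ∫⁻ x, f (x, y) ∂μ ∂ρ
      ≤ ∫⁻ y, C * (∫⁻ x, f (x, y) ^ q ∂ν) ^ (1 / q) ∂ρ :=
        lintegral_mono fun y => h _ (hf.comp measurable_prodMk_right)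
    _ = C * ∫⁻ y, (∫⁻ x, f (x, y) ^ q ∂ν) ^ (1 / q) ∂ρ := lintegral_const_mul _ hm
    _ ≤ C * (1 * (∫⁻ y, ((∫⁻ x, f (x, y) ^ q ∂ν) ^ (1 / q)) ^ q ∂ρ) ^ (1 / q)) :=
        mul_le_mul_right (refl hpq ρ _ hm) _
    _ = _ := by simp_rw [← ENNReal.rpow_mul, one_div_mul_cancel hq, ENNReal.rpow_one, one_mul]

lemma pi (hpq : p.HolderConjugate q) {n : ℕ} {μ ν : Fin n → Measure ℝ}
    [∀ i, IsProbabilityMeasure (μ i)] [∀ i, IsProbabilityMeasure (ν i)] (i : Fin n)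
    (h : HolderDominated q C (μ i) (ν i)) (hne : ∀ j, j ≠ i → μ j = ν j) :
    HolderDominated q C (Measure.pi μ) (Measure.pi ν) := by
  obtain _ | n := n
  · exact i.elim0
  have hrest : (fun j => μ (i.succAbove j)) = fun j => ν (i.succAbove j) :=
    funext fun j => hne _ (Fin.succAbove_ne i j)
  have h1 := (measurePreserving_piFinSuccAbove μ i).symm.map_eq
  have h2 := (measurePreserving_piFinSuccAbove ν i).symm.map_eq
  rw [← h1, ← h2, hrest]
  exact (h.prod hpq _).map (MeasurableEquiv.measurable _)

/-- Hölder is applied to the density ratio `r`. Multiplying the density at `m'` by `r ^ p` tilts it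
to mean `m' + p * (m - m')`, so completing the square gives the `p`-th moment of `r`; its `p`-th
root is the constant. -/
lemma gaussianReal (hpq : p.HolderConjugate q) (m m' : ℝ) {v : NNReal} (hv : v ≠ 0) :
    HolderDominated q (ENNReal.ofReal (Real.exp ((p - 1) * ((m - m') ^ 2 / (2 * v)))))
      (gaussianReal m v) (gaussianReal m' v) := by
  intro f hf
  have hv' : (0 : ℝ) < v := by positivity
  have hp : 0 < p := hpq.pos
  set r : ℝ → ℝ := fun x => Real.exp (((x - m') ^ 2 - (x - m) ^ 2) / (2 * v)) with hr
  have hrm : Measurable r := by fun_prop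
  have hpdf : ∀ x, gaussianPDFReal m v x = gaussianPDFReal m' v x * r x := fun x => by
    simp only [gaussianPDFReal, hr, mul_assoc, ← Real.exp_add]
    congr 3
    ring
  have hpow : ∀ x, gaussianPDFReal m' v x * r x ^ p =
      Real.exp (p * (p - 1) * ((m - m') ^ 2 / (2 * v))) *
        gaussianPDFReal (m' + p * (m - m')) v x := fun x => by
    simp only [gaussianPDFReal, hr, ← Real.exp_mul]
    rw [mul_assoc, ← Real.exp_add, mul_left_comm, ← Real.exp_add]
    congr 2
    field_simp
    ring
  have hL : ∫⁻ x, f x ∂ProbabilityTheory.gaussianReal m v =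
      ∫⁻ x, ENNReal.ofReal (r x) * f x ∂ProbabilityTheory.gaussianReal m' v := by
    rw [gaussianReal_of_var_ne_zero _ hv, gaussianReal_of_var_ne_zero _ hv,
      lintegral_withDensity_eq_lintegral_mul _ (measurable_gaussianPDF _ _) hf,
      lintegral_withDensity_eq_lintegral_mul _ (measurable_gaussianPDF _ _)
        (show Measurable fun x => ENNReal.ofReal (r x) * f x from hrm.ennreal_ofReal.mul hf)]
    refine lintegral_congr fun x => ?_
    simp only [Pi.mul_apply, gaussianPDF]
    rw [hpdf, ENNReal.ofReal_mul (gaussianPDFReal_nonneg _ _ _), mul_assoc]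
  have hR : ∫⁻ x, ENNReal.ofReal (r x) ^ p ∂ProbabilityTheory.gaussianReal m' v =
      ENNReal.ofReal (Real.exp (p * (p - 1) * ((m - m') ^ 2 / (2 * v)))) := by
    rw [gaussianReal_of_var_ne_zero _ hv,
      lintegral_withDensity_eq_lintegral_mul _ (measurable_gaussianPDF _ _)
        (hrm.ennreal_ofReal.pow_const p)]
    simp only [Pi.mul_apply, gaussianPDF]
    have : ∀ x, ENNReal.ofReal (gaussianPDFReal m' v x) * ENNReal.ofReal (r x) ^ p =
        ENNReal.ofReal (Real.exp (p * (p - 1) * ((m - m') ^ 2 / (2 * v)))) *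
          gaussianPDF (m' + p * (m - m')) v x := fun x => by
      rw [ENNReal.ofReal_rpow_of_pos (Real.exp_pos _),
        ← ENNReal.ofReal_mul (gaussianPDFReal_nonneg _ _ _), hpow,
        ENNReal.ofReal_mul (Real.exp_nonneg _), gaussianPDF]
    simp_rw [this]
    rw [lintegral_const_mul _ (measurable_gaussianPDF _ _), lintegral_gaussianPDF_eq_one _ hv,
      mul_one]
  rw [hL]
  refine (ENNReal.lintegral_mul_le_Lp_mul_Lq _ hpq hrm.ennreal_ofReal.aemeasurable
    hf.aemeasurable).trans (le_of_eq ?_)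
  rw [hR, ENNReal.ofReal_rpow_of_pos (Real.exp_pos _), ← Real.exp_mul]
  congr 3
  field_simp

lemma absolutelyContinuous {μ ν : Measure Ω} (hq : 0 < q) (h : HolderDominated q C μ ν) :
    μ ≪ ν := by
  refine Measure.AbsolutelyContinuous.mk fun s hs hνs => ?_
  have := h (s.indicator 1) (measurable_one.indicator hs)
  have hpow : ∀ ω, (s.indicator 1 ω : ENNReal) ^ q = s.indicator 1 ω := fun ω => by
    by_cases hω : ω ∈ s <;> simp [hω, hq]
  simp_rw [hpow, lintegral_indicator_one hs, hνs] at this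
  simpa [hq] using this

/-- Converse of Hölder: the extremal test function is the density to the power `p - 1`. Truncating
at `n` makes the moment finite, so it can be cancelled; monotone convergence removes the truncation.
-/
lemma lintegral_rnDeriv_rpow_le (hpq : p.HolderConjugate q) {μ ν : Measure Ω} [IsFiniteMeasure μ]
    [IsFiniteMeasure ν] (h : HolderDominated q C μ ν) :
    ∫⁻ ω, μ.rnDeriv ν ω ^ p ∂ν ≤ C ^ p := by
  have hac := h.absolutelyContinuous hpq.symm.pos
  have hp := hpq.pos
  have hp1 := hpq.lt
  set r := μ.rnDeriv ν with hr
  have hrm : Measurable r := Measure.measurable_rnDeriv μ ν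
  have hbdd : ∀ n : ℕ, ∫⁻ ω, min (r ω) n ^ p ∂ν ≤ C ^ p := fun n => by
    set I := ∫⁻ ω, min (r ω) n ^ p ∂ν with hI
    have hm : Measurable fun ω => min (r ω) (n : ENNReal) := hrm.min measurable_const
    have hfin : I ≠ ⊤ := by
      refine ne_top_of_le_ne_top ?_ (lintegral_mono (g := fun _ => (n : ENNReal) ^ p) fun ω =>
        ENNReal.rpow_le_rpow (min_le_right _ _) hp.le)
      rw [lintegral_const]
      exact ENNReal.mul_ne_top (ENNReal.rpow_ne_top_of_nonneg hp.le (ENNReal.natCast_ne_top n))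
        (measure_ne_top _ _)
    have key : I ≤ C * I ^ (1 / q) := by
      calc I ≤ ∫⁻ ω, r ω * min (r ω) n ^ (p - 1) ∂ν := by
            refine lintegral_mono fun ω => ?_
            calc min (r ω) (n : ENNReal) ^ p
                = min (r ω) n ^ (1 : ℝ) * min (r ω) n ^ (p - 1) := by
                  rw [← ENNReal.rpow_add_of_nonneg _ _ zero_le_one (by linarith)]
                  congr 1
                  ring
              _ ≤ r ω * min (r ω) n ^ (p - 1) := by
                  rw [ENNReal.rpow_one]
                  exact mul_le_mul_left (min_le_left _ _) _
        _ = ∫⁻ ω, min (r ω) n ^ (p - 1) ∂μ :=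
            lintegral_rnDeriv_mul hac (hm.pow_const _).aemeasurable
        _ ≤ C * (∫⁻ ω, (min (r ω) n ^ (p - 1)) ^ q ∂ν) ^ (1 / q) := h _ (hm.pow_const _)
        _ = C * I ^ (1 / q) := by simp_rw [← ENNReal.rpow_mul, hpq.sub_one_mul_conj, hI]
    by_cases hI0 : I = 0
    · rw [hI0]
      exact zero_le
    -- Dividing `key` by `I ^ (1 / q)` leaves `I ^ (1 / p)`; the subtraction of exponents needs `I`
    -- nonzero and finite.
    have hle : I ^ (1 / p) ≤ C := by
      have hsum : 1 / p = 1 - 1 / q := by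
        have := hpq.inv_add_inv_eq_one
        simp only [one_div]
        linarith
      rw [hsum, ENNReal.rpow_sub _ _ hI0 hfin, ENNReal.rpow_one]
      exact ENNReal.div_le_of_le_mul key
    calc I = (I ^ (1 / p)) ^ p := by
          rw [← ENNReal.rpow_mul, one_div_mul_cancel hp.ne', ENNReal.rpow_one]
      _ ≤ C ^ p := ENNReal.rpow_le_rpow hle hp.le
  have hsup : ∀ ω, r ω ^ p = ⨆ n : ℕ, min (r ω) n ^ p := fun ω => by
    refine le_antisymm ?_ (iSup_le fun n => ENNReal.rpow_le_rpow (min_le_left _ _) hp.le)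
    have ht : Filter.Tendsto (fun n : ℕ => min (r ω) (n : ENNReal) ^ p) Filter.atTop
        (nhds (r ω ^ p)) := by
      have h1 : Filter.Tendsto (fun n : ℕ => min (r ω) (n : ENNReal)) Filter.atTop
          (nhds (min (r ω) ⊤)) := tendsto_const_nhds.min ENNReal.tendsto_nat_nhds_top
      rw [min_top_right] at h1
      exact (ENNReal.continuous_rpow_const.tendsto _).comp h1
    exact le_of_tendsto' ht fun n => le_iSup (fun n : ℕ => min (r ω) (n : ENNReal) ^ p) n
  simp_rw [hsup]
  rw [lintegral_iSup (fun n => (hrm.min measurable_const).pow_const p)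
    (fun a b hab ω => ENNReal.rpow_le_rpow (min_le_min le_rfl (by exact_mod_cast hab)) hp.le)]
  exact iSup_le hbdd

end HolderDominated

/-! ### From moment bounds to divergences, including order 1 -/

section RenyiDivergence

variable {Ω : Type*} [MeasurableSpace Ω] {μ ν : Measure Ω} [IsProbabilityMeasure μ]
  [IsProbabilityMeasure ν] {ε : ℝ}

lemma lintegral_rnDeriv_rpow_le_exp {p : ℝ} (hp : 1 < p)
    (h : HolderDominated p.conjExponent (ENNReal.ofReal (Real.exp ((p - 1) * ε))) μ ν) :
    ∫⁻ ω, μ.rnDeriv ν ω ^ p ∂ν ≤ ENNReal.ofReal (Real.exp ((p - 1) * (ε * p))) := by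
  refine (h.lintegral_rnDeriv_rpow_le (Real.HolderConjugate.conjExponent hp)).trans (le_of_eq ?_)
  rw [ENNReal.ofReal_rpow_of_pos (Real.exp_pos _), ← Real.exp_mul, mul_assoc]

omit [IsProbabilityMeasure μ] [IsProbabilityMeasure ν] in
lemma renyiDiv_le_of_lintegral_le {p : ℝ} (hp : 1 < p) (hac : μ ≪ ν)
    (h : ∫⁻ ω, μ.rnDeriv ν ω ^ p ∂ν ≤ ENNReal.ofReal (Real.exp ((p - 1) * ε))) :
    renyiDiv p μ ν ≤ (ε : EReal) := by
  have hp0 : 0 < p - 1 := by linarith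
  rw [renyiDiv, if_neg hp.ne', if_pos hac]
  have hlog := ENNReal.log_monotone h
  rw [ENNReal.log_ofReal_of_pos (Real.exp_pos _), Real.log_exp] at hlog
  calc _ ≤ (((p - 1)⁻¹ : ℝ) : EReal) * (((p - 1) * ε : ℝ) : EReal) :=
        mul_le_mul_of_nonneg_left hlog (by exact_mod_cast (inv_pos.2 hp0).le)
    _ = ε := by rw [← EReal.coe_mul, inv_mul_cancel_left₀ hp0.ne']

/-- This is `x + 1 ≤ exp x` at `x = s * (log r - ε)`, multiplied by `r / s`. Negative terms are
moved across so that both sides can be integrated in `ENNReal`. -/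
lemma klFun_add_le {s r : ℝ} (hs : 0 < s) (hr : 0 ≤ r) :
    InformationTheory.klFun r + r * (1 + s⁻¹) ≤
      s⁻¹ * Real.exp (-(s * ε)) * r ^ (1 + s) + ε * r + 1 := by
  obtain rfl | hr := hr.eq_or_lt
  · rw [Real.zero_rpow (by positivity)]
    simp [InformationTheory.klFun]
  have hlog := Real.add_one_le_exp (s * (Real.log r - ε))
  have hexp : Real.exp (s * (Real.log r - ε)) = Real.exp (-(s * ε)) * r ^ s := by
    rw [Real.rpow_def_of_pos hr, ← Real.exp_add]
    congr 1
    ring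
  rw [hexp] at hlog
  have hmul := mul_le_mul_of_nonneg_left hlog (mul_nonneg (inv_pos.2 hs).le hr.le)
  have hss : s⁻¹ * s = 1 := inv_mul_cancel₀ hs.ne'
  rw [Real.rpow_add hr, Real.rpow_one, InformationTheory.klFun]
  linear_combination hmul + r * (Real.log r - ε) * (-hss)

/-- The Kullback-Leibler divergence is at most the Renyi divergence of every order `1 + s > 1`. -/
lemma klDiv_le_of_lintegral_le {s : ℝ} (hs : 0 < s) (hε : 0 ≤ ε) (hac : μ ≪ ν)
    (h : ∫⁻ ω, μ.rnDeriv ν ω ^ (1 + s) ∂ν ≤ ENNReal.ofReal (Real.exp (s * ε))) :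
    InformationTheory.klDiv μ ν ≤ ENNReal.ofReal ε := by
  have hrm : Measurable (μ.rnDeriv ν) := Measure.measurable_rnDeriv μ ν
  have hint : ∫⁻ ω, μ.rnDeriv ν ω ∂ν = 1 := by
    rw [Measure.lintegral_rnDeriv hac, measure_univ]
  have hs' : 0 < s⁻¹ := inv_pos.2 hs
  have hklm : Measurable fun ω =>
      ENNReal.ofReal (InformationTheory.klFun (μ.rnDeriv ν ω).toReal) := by fun_prop
  have hpt : ∀ᵐ ω ∂ν, ENNReal.ofReal (InformationTheory.klFun (μ.rnDeriv ν ω).toReal) +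
      ENNReal.ofReal (1 + s⁻¹) * μ.rnDeriv ν ω ≤
      ENNReal.ofReal (s⁻¹ * Real.exp (-(s * ε))) * μ.rnDeriv ν ω ^ (1 + s) +
        ENNReal.ofReal ε * μ.rnDeriv ν ω + 1 := by
    filter_upwards [Measure.rnDeriv_lt_top μ ν] with ω hω
    obtain ⟨r, hr⟩ : ∃ r : NNReal, (r : ENNReal) = μ.rnDeriv ν ω := ⟨_, ENNReal.coe_toNNReal hω.ne⟩
    rw [← hr, ENNReal.coe_toReal]
    have hrr : (r : ENNReal) = ENNReal.ofReal r := (ENNReal.ofReal_coe_nnreal).symm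
    rw [hrr, ENNReal.ofReal_rpow_of_nonneg r.coe_nonneg (by positivity), ← ENNReal.ofReal_one,
      ← ENNReal.ofReal_mul (by positivity), ← ENNReal.ofReal_mul (by positivity),
      ← ENNReal.ofReal_mul (by positivity),
      ← ENNReal.ofReal_add (InformationTheory.klFun_nonneg r.coe_nonneg) (by positivity),
      ← ENNReal.ofReal_add (by positivity) (by positivity),
      ← ENNReal.ofReal_add (by positivity) (by positivity)]
    refine ENNReal.ofReal_le_ofReal ?_
    rw [mul_comm (1 + s⁻¹)]
    exact klFun_add_le hs r.coe_nonneg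
  have hle := lintegral_mono_ae hpt
  rw [lintegral_add_left hklm, lintegral_const_mul _ hrm, hint,
    ← InformationTheory.klDiv_eq_lintegral_klFun_of_ac hac,
    lintegral_add_right _ measurable_const, lintegral_add_right _ (hrm.const_mul _),
    lintegral_const_mul _ hrm, lintegral_const_mul _ (hrm.pow_const _), hint, lintegral_const,
    measure_univ, mul_one, mul_one, mul_one] at hle
  -- The factor `exp (-(s * ε))` was chosen to cancel the moment bound exactly.
  have hconst : ENNReal.ofReal (s⁻¹ * Real.exp (-(s * ε))) * ENNReal.ofReal (Real.exp (s * ε)) =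
      ENNReal.ofReal s⁻¹ := by
    rw [← ENNReal.ofReal_mul (by positivity), mul_assoc, ← Real.exp_add, neg_add_cancel,
      Real.exp_zero, mul_one]
  have hfinal := hle.trans (add_le_add_left (add_le_add_left (mul_le_mul_right h _) _) _)
  rw [hconst] at hfinal
  have hE : ENNReal.ofReal s⁻¹ + ENNReal.ofReal ε + 1 =
      ENNReal.ofReal ε + ENNReal.ofReal (1 + s⁻¹) := by
    rw [ENNReal.ofReal_add zero_le_one hs'.le, ENNReal.ofReal_one]
    ring
  rw [hE] at hfinal
  exact (ENNReal.add_le_add_iff_right ENNReal.ofReal_ne_top).1 hfinal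

lemma renyiDiv_le_of_holderDominated (hε : 0 ≤ ε)
    (h : ∀ p : ℝ, 1 < p →
      HolderDominated p.conjExponent (ENNReal.ofReal (Real.exp ((p - 1) * ε))) μ ν)
    {α : ℝ} (hα : 1 ≤ α) : renyiDiv α μ ν ≤ ((ε * α : ℝ) : EReal) := by
  have hac : μ ≪ ν := (h 2 one_lt_two).absolutelyContinuous
    (Real.HolderConjugate.conjExponent one_lt_two).symm.pos
  obtain rfl | hα := hα.eq_or_lt
  · rw [renyiDiv, if_pos rfl]
    have hkl : InformationTheory.klDiv μ ν ≤ ENNReal.ofReal (ε * 1) := by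
      -- Order `1 + s` bounds the divergence by `ε * (1 + s)`; now `s` tends to 0 from above.
      have hs : ∀ s : ℝ, 0 < s → InformationTheory.klDiv μ ν ≤ ENNReal.ofReal (ε * (1 + s)) := by
        intro s hs
        have := lintegral_rnDeriv_rpow_le_exp (by linarith) (h (1 + s) (by linarith))
        rw [add_sub_cancel_left] at this
        exact klDiv_le_of_lintegral_le hs (by positivity) hac this
      have ht : Filter.Tendsto (fun s : ℝ => ENNReal.ofReal (ε * (1 + s)))
          (nhdsWithin 0 (Set.Ioi 0)) (nhds (ENNReal.ofReal (ε * 1))) := by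
        have hc : Continuous fun s : ℝ => ENNReal.ofReal (ε * (1 + s)) := 
          ENNReal.continuous_ofReal.comp (by fun_prop)
        simpa using (hc.tendsto 0).mono_left nhdsWithin_le_nhds
      exact ge_of_tendsto ht (by filter_upwards [self_mem_nhdsWithin] with s hs' using hs s hs')
    calc ((InformationTheory.klDiv μ ν : ENNReal) : EReal) ≤ (ENNReal.ofReal (ε * 1) : EReal) := by
          exact_mod_cast hkl
      _ = ((ε * 1 : ℝ) : EReal) := by rw [EReal.coe_ennreal_ofReal, max_eq_left (by positivity)]
  · exact renyiDiv_le_of_lintegral_le hα hac (lintegral_rnDeriv_rpow_le_exp hα (h α hα))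

end RenyiDivergence

/-! ### Weighted bounds and adaptive composition -/

/-- The bound of `HolderDominated` for the measure `μ` weighted by the function `w`. -/
def WeightedHolderDominated {Ω : Type*} [MeasurableSpace Ω] (q : ℝ) (C : ENNReal) (w : Ω → ENNReal)
    (μ ν : Measure Ω) : Prop :=
  ∀ f : Ω → ENNReal, Measurable f → ∫⁻ ω, f ω * w ω ∂μ ≤ C * (∫⁻ ω, f ω ^ q ∂ν) ^ (1 / q)

section Weighted

variable {Ω Ω' : Type*} [MeasurableSpace Ω] [MeasurableSpace Ω'] {q : ℝ} {C D : ENNReal}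
  {w : Ω → ENNReal} {w' : Ω' → ENNReal} {μ ν : Measure Ω}

/-- In budget terms, `a` is what is left after a release of price `D`, and `a * D` is what was there
before. -/
lemma HolderDominated.weighted_const (h : HolderDominated q D μ ν) (a : ENNReal) :
    WeightedHolderDominated q (a * D) (fun _ => a) μ ν := by
  intro f hf
  rw [lintegral_mul_const _ hf, mul_comm, mul_assoc]
  exact mul_le_mul_right (h f hf) a

namespace WeightedHolderDominated

lemma map (h : WeightedHolderDominated q C w μ ν) {g : Ω → Ω'} (hg : Measurable g)
    (hw : ∀ ω, w' (g ω) = w ω) : WeightedHolderDominated q C w' (μ.map g) (ν.map g) := by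
  intro f hf
  rw [lintegral_map (hf.pow_const q) hg]
  -- Only an upper bound is needed on this side, so `w'` may be non-measurable.
  refine (lintegral_map_le _ _).trans ?_
  simp_rw [hw]
  exact h _ (hf.comp hg)

/-- Adaptive composition: the constant of the second mechanism is the weight after the first. -/
lemma bind (hq : 0 < q) (h : WeightedHolderDominated q C w μ ν) {κ κ' : Ω → Measure Ω'}
    (hκ' : Measurable κ') (hstep : ∀ ω, WeightedHolderDominated q (w ω) w' (κ ω) (κ' ω)) :
    WeightedHolderDominated q C w' (μ.bind κ) (ν.bind κ') := by
  intro f hf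
  have hfq := hf.pow_const q
  have hm : Measurable fun ω => (∫⁻ y, f y ^ q ∂κ' ω) ^ (1 / q) :=
    ((Measure.measurable_lintegral hfq).comp hκ').pow_const _
  calc ∫⁻ y, f y * w' y ∂μ.bind κ
      ≤ ∫⁻ ω, ∫⁻ y, f y * w' y ∂κ ω ∂μ := Measure.lintegral_bind_le _ _ _
    _ ≤ ∫⁻ ω, (∫⁻ y, f y ^ q ∂κ' ω) ^ (1 / q) * w ω ∂μ :=
        lintegral_mono fun ω => (hstep ω f hf).trans_eq (mul_comm _ _)
    -- The test function for the first mechanism is the `L^q` norm of `f` under the second.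
    _ ≤ C * (∫⁻ ω, ((∫⁻ y, f y ^ q ∂κ' ω) ^ (1 / q)) ^ q ∂ν) ^ (1 / q) := h _ hm
    _ = C * (∫⁻ y, f y ^ q ∂ν.bind κ') ^ (1 / q) := by
        rw [Measure.lintegral_bind hκ'.aemeasurable hfq.aemeasurable]
        simp_rw [← ENNReal.rpow_mul, one_div_mul_cancel hq.ne', ENNReal.rpow_one]

lemma holderDominated (h : WeightedHolderDominated q C w μ ν) (hw : ∀ ω, 1 ≤ w ω) :
    HolderDominated q C μ ν := fun f hf =>
  (lintegral_mono fun ω => by simpa using mul_le_mul_right (hw ω) (f ω)).trans (h f hf)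

end WeightedHolderDominated

end Weighted

/-! ### Measurable families of measures -/

section Measurability

variable {A Y Z : Type*} [MeasurableSpace A] [MeasurableSpace Y] [MeasurableSpace Z]

lemma Measurable.measure_map_uncurry {κ : A → Measure Y} (hκ : Measurable κ)
    [∀ a, IsProbabilityMeasure (κ a)] {g : A → Y → Z} (hg : Measurable (Function.uncurry g)) :
    Measurable fun a => (κ a).map (g a) := by
  let k : Kernel A Y := ⟨κ, hκ⟩
  have : IsMarkovKernel k := ⟨fun a => inferInstanceAs (IsProbabilityMeasure (κ a))⟩
  refine Measure.measurable_of_measurable_coe _ fun s hs => ?_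
  have h := Kernel.measurable_kernel_prodMk_left (κ := k) (hg hs)
  convert h using 2 with a
  exact Measure.map_apply (hg.comp measurable_prodMk_left) hs

lemma Measurable.measure_bind_uncurry {κ : A → Measure Y} (hκ : Measurable κ)
    [∀ a, IsProbabilityMeasure (κ a)] {g : A → Y → Measure Z}
    (hg : Measurable (Function.uncurry g)) : Measurable fun a => (κ a).bind (g a) := by
  let k : Kernel A Y := ⟨κ, hκ⟩
  have : IsMarkovKernel k := ⟨fun a => inferInstanceAs (IsProbabilityMeasure (κ a))⟩
  refine Measure.measurable_of_measurable_coe _ fun s hs => ?_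
  have h := Measurable.lintegral_kernel_prod_right (κ := k) (f := fun a y => g a y s)
    ((Measure.measurable_coe hs).comp hg)
  convert h using 2 with a
  exact Measure.bind_apply hs (hg.comp measurable_prodMk_left).aemeasurable

lemma Measurable.measure_pi {n : ℕ} {κ : Fin n → A → Measure Y} (hκ : ∀ i, Measurable (κ i))
    [∀ i a, IsProbabilityMeasure (κ i a)] : Measurable fun a => Measure.pi fun i => κ i a := by
  refine Measurable.measure_of_isPiSystem_of_isProbabilityMeasure generateFrom_pi.symm
    isPiSystem_pi ?_
  rintro _ ⟨s, hs, rfl⟩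
  simp_rw [Measure.pi_pi]
  exact Finset.measurable_fun_prod _ fun i _ =>
    (Measure.measurable_coe (hs i (Set.mem_univ i))).comp (hκ i)

lemma measurable_finSnoc {n : ℕ} :
    Measurable fun a : (Fin n → Y) × Y => (Fin.snoc a.1 a.2 : Fin (n + 1) → Y) := by
  refine measurable_pi_iff.2 fun i => ?_
  refine Fin.lastCases ?_ (fun i => ?_) i
  · simpa using measurable_snd
  · simpa [Function.comp_def] using (measurable_pi_apply i).comp (measurable_fst (β := Y))

lemma measurable_list_map_sum {ι M : Type*} [AddMonoid M] [MeasurableSpace M] [MeasurableAdd₂ M]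
    {g : ι → A → M} (hg : ∀ i, Measurable (g i)) (l : List ι) :
    Measurable fun a => (l.map fun i => g i a).sum := by
  induction l with
  | nil => simp
  | cons i l ih =>
    simp only [List.map_cons, List.sum_cons]
    exact (hg i).add ih

lemma measurable_argMax {c : ℕ} [NeZero c] : Measurable (argMax : (Fin c → ℝ) → Fin c) := by
  classical
  refine measurable_to_countable' fun j => ?_
  have h : argMax ⁻¹' {j} = {v : Fin c → ℝ | (∀ k, v k ≤ v j) ∧
      ∀ i, (∀ k, v k ≤ v i) → j ≤ i} := by
    ext v
    simp only [Set.mem_preimage, Set.mem_singleton_iff, Set.mem_ofPred_eq, argMax,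
      Finset.min'_eq_iff, Finset.mem_filter, Finset.mem_univ, true_and]
  rw [h]
  measurability

end Measurability

/-! ### Measurability of the algorithm and total mass of its laws -/

namespace IndKNN

variable {X : Type*} [MeasurableSpace X] {c : ℕ} {P : IndKNN X} {A : Type*} [MeasurableSpace A]

lemma measurable_selected (hkappa : ∀ x, Measurable (P.kappa x)) (x : X) :
    Measurable (P.selected x) := by
  classical
  unfold selected
  exact Measurable.ite (measurableSet_le measurable_const (hkappa x)) measurable_const
    measurable_const

omit [MeasurableSpace X] in
lemma measurableSet_active {z : A → ℝ} (hz : Measurable z) :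
    MeasurableSet {a | P.Active (z a)} :=
  measurableSet_le measurable_const hz

omit [MeasurableSpace X] in
lemma measurable_clamp : Measurable P.clamp := measurable_id.max measurable_const

lemma measurable_afterCount (hkappa : ∀ x, Measurable (P.kappa x)) (x : X) {q : A → X} {z : A → ℝ}
    (hq : Measurable q) (hz : Measurable z) : Measurable fun a => P.afterCount (q a) x (z a) :=
  hz.sub (((measurable_selected hkappa x).comp hq).const_mul _)

lemma measurable_contribution (hkappa : ∀ x, Measurable (P.kappa x)) (p : X × Fin c)
    {q : A → X} {K z : A → ℝ} (hq : Measurable q) (hK : Measurable K) (hz : Measurable z) :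
    Measurable fun a => P.contribution (q a) (K a) p (z a) := by
  refine measurable_pi_iff.2 fun j => ?_
  have h1 := (measurable_selected hkappa p.1).comp hq
  have h2 := (hkappa p.1).comp hq
  have h3 := (measurable_clamp (P := P)).comp hK
  exact ((h2.mul_const _).mul h1).min (((h3.const_mul 2).mul hz).sqrt.const_mul _)

lemma measurable_afterLabel (hkappa : ∀ x, Measurable (P.kappa x)) (p : X × Fin c)
    {q : A → X} {K z : A → ℝ} (hq : Measurable q) (hK : Measurable K) (hz : Measurable z) :
    Measurable fun a => P.afterLabel (q a) (K a) p (z a) := by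
  have h1 := measurable_pi_iff.1 (measurable_contribution hkappa p hq hK hz)
  have h2 := (measurable_clamp (P := P)).comp hK
  exact hz.sub ((Finset.measurable_fun_sum _ fun j _ => (h1 j).pow_const 2).div (h2.const_mul _))

lemma measurable_budget (hkappa : ∀ x, Measurable (P.kappa x)) (p : X × Fin c) (t : ℕ) :
    Measurable (P.budget p t) := by
  classical
  induction t with
  | zero => exact measurable_const
  | succ t ih =>
    have hz : Measurable fun h : Fin (t + 1) → Round X c => P.budget p t (Fin.init h) :=
      ih.comp (measurable_pi_iff.2 fun i => measurable_pi_apply _)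
    have hr : Measurable fun h : Fin (t + 1) → Round X c => h (Fin.last t) := measurable_pi_apply _
    exact Measurable.ite (measurableSet_active hz)
      (measurable_afterLabel hkappa p hr.fst hr.snd.fst
        (measurable_afterCount hkappa p.1 hr.fst hz)) hz

lemma measurable_count (hkappa : ∀ x, Measurable (P.kappa x)) (S : List (X × Fin c)) (t : ℕ) :
    Measurable fun a : (Fin t → Round X c) × X => P.count S a.1 a.2 := by
  classical
  exact measurable_list_map_sum (fun p => Measurable.ite
    (measurableSet_active ((measurable_budget hkappa p t).comp measurable_fst))
    ((measurable_selected hkappa p.1).comp measurable_snd) measurable_const) S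

lemma measurable_votes (hkappa : ∀ x, Measurable (P.kappa x)) (S : List (X × Fin c)) (t : ℕ) :
    Measurable fun a : ((Fin t → Round X c) × X) × ℝ => P.votes S a.1.1 a.1.2 a.2 := by
  classical
  have hz (p : X × Fin c) : Measurable fun a : ((Fin t → Round X c) × X) × ℝ =>
      P.budget p t a.1.1 := (measurable_budget hkappa p t).comp measurable_fst.fst
  exact measurable_list_map_sum (fun p => Measurable.ite (measurableSet_active (hz p))
    (measurable_contribution hkappa p measurable_fst.snd measurable_snd
      (measurable_afterCount hkappa p.1 measurable_fst.snd (hz p))) measurable_const) S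

instance (S : List (X × Fin c)) {t : ℕ} (h : Fin t → Round X c) (q : X) :
    IsProbabilityMeasure (P.countLaw S h q) := by
  unfold countLaw
  infer_instance

lemma measurable_countLaw (hkappa : ∀ x, Measurable (P.kappa x)) (S : List (X × Fin c)) (t : ℕ) :
    Measurable fun a : (Fin t → Round X c) × X => P.countLaw S a.1 a.2 :=
  measurable_gaussianReal.comp ((measurable_count hkappa S t).prodMk measurable_const)

variable [NeZero c]

instance (S : List (X × Fin c)) {t : ℕ} (h : Fin t → Round X c) (q : X) (K : ℝ) :
    IsProbabilityMeasure (P.labelLaw S h q K) :=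
  Measure.isProbabilityMeasure_map measurable_argMax.aemeasurable

lemma measurable_labelLaw (hkappa : ∀ x, Measurable (P.kappa x)) (S : List (X × Fin c)) (t : ℕ) :
    Measurable fun a : ((Fin t → Round X c) × X) × ℝ => P.labelLaw S a.1.1 a.1.2 a.2 := by
  refine (Measure.measurable_map _ measurable_argMax).comp (Measurable.measure_pi fun j => ?_)
  exact measurable_gaussianReal.comp
    ((measurable_pi_iff.1 (measurable_votes hkappa S t) j).prodMk
      ((measurable_clamp.comp measurable_snd).const_mul _).real_toNNReal)

/-- The law of the label, with the label appended to the transcript. -/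
noncomputable def labelStep (P : IndKNN X) (S : List (X × Fin c)) {t : ℕ} (h : Fin t → Round X c) (q : X)
    (K : ℝ) : Measure (Fin (t + 1) → Round X c) :=
  (P.labelLaw S h q K).map fun a => Fin.snoc h (q, K, a)

/-- The law of the transcript with one more round, given its beginning and the new query. -/
noncomputable def countStep (P : IndKNN X) (S : List (X × Fin c)) {t : ℕ} (h : Fin t → Round X c) (q : X) :
    Measure (Fin (t + 1) → Round X c) :=
  (P.countLaw S h q).bind (P.labelStep S h q)

/-- The law of the transcript with one more round, given its beginning. -/
noncomputable def roundStep (P : IndKNN X) (Q : (t : ℕ) → Kernel (Fin t → Round X c) X) (S : List (X × Fin c))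
    {t : ℕ} (h : Fin t → Round X c) : Measure (Fin (t + 1) → Round X c) :=
  (Q t h).bind (P.countStep S h)

lemma transcript_succ (Q : (t : ℕ) → Kernel (Fin t → Round X c) X) (S : List (X × Fin c)) (t : ℕ) :
    P.transcript Q S (t + 1) = (P.transcript Q S t).bind (P.roundStep Q S) := rfl

omit [NeZero c] in
lemma measurable_snoc_round {t : ℕ} (h : Fin t → Round X c) (q : X) (K : ℝ) :
    Measurable fun a : Fin c => (Fin.snoc h (q, K, a) : Fin (t + 1) → Round X c) :=
  measurable_of_finite _

lemma measurable_labelStep (hkappa : ∀ x, Measurable (P.kappa x)) (S : List (X × Fin c)) (t : ℕ) :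
    Measurable fun a : ((Fin t → Round X c) × X) × ℝ => P.labelStep S a.1.1 a.1.2 a.2 :=
  (measurable_labelLaw hkappa S t).measure_map_uncurry
    (g := fun a y => (Fin.snoc a.1.1 (a.1.2, a.2, y) : Fin (t + 1) → Round X c))
    (measurable_finSnoc.comp (measurable_fst.fst.fst.prodMk
      (measurable_fst.fst.snd.prodMk (measurable_fst.snd.prodMk measurable_snd))))

lemma measurable_countStep (hkappa : ∀ x, Measurable (P.kappa x)) (S : List (X × Fin c)) (t : ℕ) :
    Measurable fun a : (Fin t → Round X c) × X => P.countStep S a.1 a.2 :=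
  (measurable_countLaw hkappa S t).measure_bind_uncurry (measurable_labelStep hkappa S t)

lemma measurable_roundStep (hkappa : ∀ x, Measurable (P.kappa x))
    (Q : (t : ℕ) → Kernel (Fin t → Round X c) X) (hQ : ∀ t, IsMarkovKernel (Q t))
    (S : List (X × Fin c)) (t : ℕ) :
    Measurable fun h : Fin t → Round X c => P.roundStep Q S h :=
  (Q t).measurable.measure_bind_uncurry (measurable_countStep hkappa S t)

lemma isProbabilityMeasure_transcript (hkappa : ∀ x, Measurable (P.kappa x))
    (Q : (t : ℕ) → Kernel (Fin t → Round X c) X) (hQ : ∀ t, IsMarkovKernel (Q t))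
    (S : List (X × Fin c)) (t : ℕ) : IsProbabilityMeasure (P.transcript Q S t) := by
  induction t with
  | zero => exact inferInstanceAs (IsProbabilityMeasure (Measure.dirac _))
  | succ t ih =>
    have hl := measurable_labelStep hkappa S t
    have hc := measurable_countStep hkappa S t
    refine isProbabilityMeasure_bind (measurable_roundStep hkappa Q hQ S t).aemeasurable
      (ae_of_all _ fun h => ?_)
    refine isProbabilityMeasure_bind (hc.comp measurable_prodMk_left).aemeasurable
      (ae_of_all _ fun q => ?_)
    refine isProbabilityMeasure_bind (hl.comp (measurable_prodMk_left (x := (h, q)))).aemeasurable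
      (ae_of_all _ fun K => ?_)
    exact Measure.isProbabilityMeasure_map (measurable_snoc_round h q K).aemeasurable

end IndKNN

/-! ### Neighbouring datasets and budget weights -/

lemma Neighbouring.exists_perm {Z : Type*} {S S' : List Z} (h : Neighbouring S S') :
    ∃ p, S.Perm (p :: S') ∨ S'.Perm (p :: S) := by
  obtain ⟨i, hi, rfl⟩ | ⟨i, hi, rfl⟩ := h
  · exact ⟨S[i], Or.inl (List.getElem_cons_eraseIdx_perm hi).symm⟩
  · exact ⟨S'[i], Or.inr (List.getElem_cons_eraseIdx_perm hi).symm⟩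

/-- Gaussian costs see only the squared shift, so adding and deleting `p` are handled together. -/
lemma sq_list_map_sum_sub_of_perm {Z : Type*} {S S' : List Z} {p : Z}
    (h : S.Perm (p :: S') ∨ S'.Perm (p :: S)) (g : Z → ℝ) :
    ((S.map g).sum - (S'.map g).sum) ^ 2 = g p ^ 2 := by
  obtain h | h := h
  · rw [(h.map g).sum_eq, List.map_cons, List.sum_cons]
    ring
  · rw [(h.map g).sum_eq, List.map_cons, List.sum_cons]
    ring

lemma list_map_sum_apply {ι Z : Type*} (S : List Z) (g : Z → ι → ℝ) (j : ι) :
    (S.map g).sum j = (S.map fun p => g p j).sum := by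
  induction S with
  | nil => rfl
  | cons p S ih => simp [ih]

/-- The factor by which the likelihood ratio may still grow if the remaining budget is `z`. -/
noncomputable def budgetWeight (p z : ℝ) : ENNReal := ENNReal.ofReal (Real.exp ((p - 1) * z))

lemma budgetWeight_mul (p z z' : ℝ) :
    budgetWeight p z * budgetWeight p z' = budgetWeight p (z + z') := by
  rw [budgetWeight, budgetWeight, budgetWeight, ← ENNReal.ofReal_mul (Real.exp_nonneg _),
    ← Real.exp_add, mul_add]

lemma one_le_budgetWeight {p z : ℝ} (hp : 1 < p) (hz : 0 ≤ z) : 1 ≤ budgetWeight p z := by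
  rw [budgetWeight, ← ENNReal.ofReal_one]
  exact ENNReal.ofReal_le_ofReal (Real.one_le_exp (mul_nonneg (by linarith) hz))

lemma budgetWeight_zero (p : ℝ) : budgetWeight p 0 = 1 := by simp [budgetWeight]

/-! ### Budget accounting for one record -/

namespace IndKNN

variable {X : Type*} {c : ℕ} {P : IndKNN X}

lemma selected_eq_zero_or_one (x q : X) : P.selected x q = 0 ∨ P.selected x q = 1 := by
  unfold selected
  split_ifs <;> simp

lemma clamp_nonneg (hfloor : 0 ≤ P.floor) (K : ℝ) : 0 ≤ P.clamp K :=
  hfloor.trans (le_max_right _ _)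

lemma weight_nonneg (hnonneg : ∀ x q, P.tau ≤ P.kappa x q → 0 ≤ P.kappa x q) (q : X)
    (p : X × Fin c) (j : Fin c) : 0 ≤ P.kappa p.1 q * oneHot p.2 j * P.selected p.1 q := by
  by_cases h : P.tau ≤ P.kappa p.1 q
  · have := hnonneg _ _ h
    unfold selected oneHot
    split_ifs <;> simp [this]
  · simp [selected, h]

lemma contribution_nonneg (hnonneg : ∀ x q, P.tau ≤ P.kappa x q → 0 ≤ P.kappa x q)
    (hsigma2 : 0 < P.sigma2) (q : X) (K : ℝ) (p : X × Fin c) (z : ℝ) (j : Fin c) :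
    0 ≤ P.contribution q K p z j :=
  le_min (weight_nonneg hnonneg q p j) (by positivity)

lemma contribution_of_ne (hsigma2 : 0 < P.sigma2) (q : X) (K : ℝ) (p : X × Fin c) (z : ℝ)
    {j : Fin c} (hj : j ≠ p.2) : P.contribution q K p z j = 0 := by
  rw [contribution, oneHot, if_neg hj, mul_zero, zero_mul]
  exact min_eq_left (by positivity)

lemma contribution_of_clamp_eq_zero
    (hnonneg : ∀ x q, P.tau ≤ P.kappa x q → 0 ≤ P.kappa x q) (q : X) {K : ℝ} (p : X × Fin c)
    (z : ℝ) (hK : P.clamp K = 0) : P.contribution q K p z = 0 := by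
  funext j
  simp [contribution, hK, weight_nonneg hnonneg q p j]

lemma sum_contribution_sq (hsigma2 : 0 < P.sigma2) (q : X) (K : ℝ) (p : X × Fin c) (z : ℝ) :
    ∑ j, P.contribution q K p z j ^ 2 = P.contribution q K p z p.2 ^ 2 :=
  Finset.sum_eq_single p.2 (fun j _ hj => by simp [contribution_of_ne hsigma2 q K p z hj])
    (by simp)

/-- The activity threshold is the largest price a count can have. -/
lemma afterCount_nonneg {q x : X} {z : ℝ} (hz : P.Active z) : 0 ≤ P.afterCount q x z := by
  unfold Active at hz
  have h : 0 ≤ 1 / (2 * P.sigma1 ^ 2) := by positivity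
  obtain hs | hs := selected_eq_zero_or_one (P := P) x q <;> rw [afterCount, hs] <;> linarith

/-- Only the entry at the record's own class is nonzero, and clipping it at `σ₂ √(2 K z)` keeps the
price at most `z`. -/
lemma afterLabel_nonneg (hnonneg : ∀ x q, P.tau ≤ P.kappa x q → 0 ≤ P.kappa x q)
    (hsigma2 : 0 < P.sigma2) (hfloor : 0 ≤ P.floor) (q : X) (K : ℝ) (p : X × Fin c) {z : ℝ}
    (hz : 0 ≤ z) : 0 ≤ P.afterLabel q K p z := by
  rw [afterLabel, sum_contribution_sq hsigma2]
  have hf : P.contribution q K p z p.2 ^ 2 ≤ z * (2 * P.sigma2 ^ 2 * P.clamp K) :=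
    calc P.contribution q K p z p.2 ^ 2
        ≤ (P.sigma2 * √(2 * P.clamp K * z)) ^ 2 :=
          pow_le_pow_left₀ (contribution_nonneg hnonneg hsigma2 q K p z p.2) (min_le_right _ _) 2
      _ = z * (2 * P.sigma2 ^ 2 * P.clamp K) := by
          rw [mul_pow, Real.sq_sqrt (by have := clamp_nonneg hfloor K; positivity)]
          ring
  have hd : 0 ≤ 2 * P.sigma2 ^ 2 * P.clamp K := by
    have := clamp_nonneg hfloor K
    positivity
  -- A zero clamped count is included: the quotient is then 0.
  linarith [div_le_of_le_mul₀ hd hz hf]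

lemma budget_nonneg (hnonneg : ∀ x q, P.tau ≤ P.kappa x q → 0 ≤ P.kappa x q)
    (hsigma2 : 0 < P.sigma2) (hB : 0 ≤ P.B) (hfloor : 0 ≤ P.floor) (p : X × Fin c) (t : ℕ)
    (h : Fin t → Round X c) : 0 ≤ P.budget p t h := by
  induction t with
  | zero => exact hB
  | succ t ih =>
    rw [budget]
    split_ifs with hz
    · exact afterLabel_nonneg hnonneg hsigma2 hfloor _ _ _ (afterCount_nonneg hz)
    · exact ih _

/-- What the record `p` adds to the neighbour count. -/
noncomputable def countTerm (P : IndKNN X) {t : ℕ} (h : Fin t → Round X c) (q : X)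
    (p : X × Fin c) : ℝ :=
  open Classical in if P.Active (P.budget p t h) then P.selected p.1 q else 0

/-- What the record `p` adds to the votes. -/
noncomputable def voteTerm (P : IndKNN X) {t : ℕ} (h : Fin t → Round X c) (q : X) (K : ℝ)
    (p : X × Fin c) : Fin c → ℝ :=
  open Classical in if P.Active (P.budget p t h) then
    P.contribution q K p (P.afterCount q p.1 (P.budget p t h)) else 0

/-- The remaining budget of the record `p` in the middle of a round. -/
noncomputable def midBudget (P : IndKNN X) {t : ℕ} (h : Fin t → Round X c) (q : X)
    (p : X × Fin c) : ℝ :=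
  P.budget p t h - countTerm P h q p ^ 2 / (2 * P.sigma1 ^ 2)

lemma voteTerm_of_ne (hsigma2 : 0 < P.sigma2) {t : ℕ} (h : Fin t → Round X c) (q : X) (K : ℝ)
    (p : X × Fin c) {j : Fin c} (hj : j ≠ p.2) : P.voteTerm h q K p j = 0 := by
  unfold voteTerm
  split_ifs
  · exact contribution_of_ne hsigma2 q K p _ hj
  · rfl

lemma voteTerm_of_clamp_eq_zero
    (hnonneg : ∀ x q, P.tau ≤ P.kappa x q → 0 ≤ P.kappa x q) {t : ℕ} (h : Fin t → Round X c)
    (q : X) {K : ℝ} (p : X × Fin c) (hK : P.clamp K = 0) : P.voteTerm h q K p = 0 := by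
  unfold voteTerm
  split_ifs
  · exact contribution_of_clamp_eq_zero hnonneg q p _ hK
  · rfl

/-- The algorithm's deductions are the two Gaussian costs: an indicator equals its square, and the
terms of an inactive record vanish. -/
lemma budget_snoc (hsigma2 : 0 < P.sigma2) {t : ℕ} (h : Fin t → Round X c) (q : X) (K : ℝ)
    (a : Fin c) (p : X × Fin c) :
    P.budget p (t + 1) (Fin.snoc h (q, K, a)) =
      P.midBudget h q p - P.voteTerm h q K p p.2 ^ 2 / (2 * P.sigma2 ^ 2 * P.clamp K) := by
  have hsel : P.selected p.1 q ^ 2 = P.selected p.1 q := by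
    obtain hs | hs := selected_eq_zero_or_one (P := P) p.1 q <;> simp [hs]
  by_cases hz : P.Active (P.budget p t h)
  · simp only [budget, Fin.init_snoc, Fin.snoc_last, midBudget, countTerm, voteTerm, if_pos hz]
    rw [if_pos (by rwa [Fin.init_snoc]), afterLabel, sum_contribution_sq hsigma2, hsel, afterCount, one_div_mul_eq_div]
  · simp [budget, midBudget, countTerm, voteTerm, hz]

lemma sq_count_sub {S S' : List (X × Fin c)} {p : X × Fin c}
    (hp : S.Perm (p :: S') ∨ S'.Perm (p :: S)) {t : ℕ} (h : Fin t → Round X c) (q : X) :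
    (P.count S h q - P.count S' h q) ^ 2 = P.countTerm h q p ^ 2 :=
  sq_list_map_sum_sub_of_perm hp (P.countTerm h q)

lemma sq_votes_sub {S S' : List (X × Fin c)} {p : X × Fin c}
    (hp : S.Perm (p :: S') ∨ S'.Perm (p :: S)) {t : ℕ} (h : Fin t → Round X c) (q : X) (K : ℝ)
    (j : Fin c) :
    (P.votes S h q K j - P.votes S' h q K j) ^ 2 = P.voteTerm h q K p j ^ 2 := by
  have hv : ∀ S : List (X × Fin c), P.votes S h q K j =
      (S.map fun p => P.voteTerm h q K p j).sum := fun S =>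
    list_map_sum_apply S (P.voteTerm h q K) j
  rw [hv, hv]
  exact sq_list_map_sum_sub_of_perm hp fun p => P.voteTerm h q K p j

lemma votes_eq_of_voteTerm_eq_zero {S S' : List (X × Fin c)} {p : X × Fin c}
    (hp : S.Perm (p :: S') ∨ S'.Perm (p :: S)) {t : ℕ} (h : Fin t → Round X c) (q : X) (K : ℝ)
    {j : Fin c} (hj : P.voteTerm h q K p j = 0) : P.votes S h q K j = P.votes S' h q K j := by
  have h2 := sq_votes_sub (P := P) hp h q K j
  rw [hj, zero_pow two_ne_zero, sq_eq_zero_iff] at h2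
  linarith

/-! ### Privacy of the releases and of the transcript -/

variable {r r' : ℝ}

lemma holderDominated_countLaw (hr : r.HolderConjugate r') (hsigma1 : 0 < P.sigma1)
    {S S' : List (X × Fin c)} {p : X × Fin c} (hp : S.Perm (p :: S') ∨ S'.Perm (p :: S)) {t : ℕ}
    (h : Fin t → Round X c) (q : X) :
    HolderDominated r' (budgetWeight r (P.countTerm h q p ^ 2 / (2 * P.sigma1 ^ 2)))
      (P.countLaw S h q) (P.countLaw S' h q) := by
  have hs : 0 < P.sigma1 ^ 2 := by positivity
  have hg := HolderDominated.gaussianReal hr (P.count S h q) (P.count S' h q)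
    (v := (P.sigma1 ^ 2).toNNReal) (Real.toNNReal_pos.2 hs).ne'
  rwa [sq_count_sub hp, Real.coe_toNNReal _ hs.le] at hg

variable [NeZero c]

lemma holderDominated_labelLaw (hnonneg : ∀ x q, P.tau ≤ P.kappa x q → 0 ≤ P.kappa x q)
    (hr : r.HolderConjugate r') (hsigma2 : 0 < P.sigma2) (hfloor : 0 ≤ P.floor)
    {S S' : List (X × Fin c)} {p : X × Fin c} (hp : S.Perm (p :: S') ∨ S'.Perm (p :: S)) {t : ℕ}
    (h : Fin t → Round X c) (q : X) (K : ℝ) :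
    HolderDominated r'
      (budgetWeight r (P.voteTerm h q K p p.2 ^ 2 / (2 * P.sigma2 ^ 2 * P.clamp K)))
      (P.labelLaw S h q K) (P.labelLaw S' h q K) := by
  -- With clamped count 0 the noise is a point mass and the Gaussian bound is unavailable; but then
  -- `p` casts no vote, so the two laws coincide.
  obtain hK | hK := (clamp_nonneg hfloor K).eq_or_lt
  · have hvote := voteTerm_of_clamp_eq_zero hnonneg h q p hK.symm
    have hlaw : P.labelLaw S h q K = P.labelLaw S' h q K := by
      have hv : P.votes S h q K = P.votes S' h q K :=
        funext fun j => votes_eq_of_voteTerm_eq_zero hp h q K (congrFun hvote j)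
      rw [labelLaw, labelLaw, hv]
    rw [hlaw, hvote, Pi.zero_apply, zero_pow two_ne_zero, zero_div, budgetWeight_zero]
    exact HolderDominated.refl hr _
  · have hs : 0 < P.sigma2 ^ 2 * P.clamp K := by positivity
    refine HolderDominated.map ?_ measurable_argMax
    refine HolderDominated.pi hr p.2 ?_ fun j hj => ?_
    · have hg := HolderDominated.gaussianReal hr (P.votes S h q K p.2) (P.votes S' h q K p.2)
        (v := (P.sigma2 ^ 2 * P.clamp K).toNNReal) (Real.toNNReal_pos.2 hs).ne'
      rwa [sq_votes_sub hp, Real.coe_toNNReal _ hs.le, ← mul_assoc] at hg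
    · rw [votes_eq_of_voteTerm_eq_zero hp h q K (voteTerm_of_ne hsigma2 h q K p hj)]

variable [MeasurableSpace X]

lemma weightedHolderDominated_transcript (hkappa : ∀ x, Measurable (P.kappa x))
    (hnonneg : ∀ x q, P.tau ≤ P.kappa x q → 0 ≤ P.kappa x q)
    (hsigma1 : 0 < P.sigma1) (hsigma2 : 0 < P.sigma2) (hfloor : 0 ≤ P.floor)
    (Q : (t : ℕ) → Kernel (Fin t → Round X c) X) (hQ : ∀ t, IsMarkovKernel (Q t))
    (hr : r.HolderConjugate r') {S S' : List (X × Fin c)} {p : X × Fin c}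
    (hp : S.Perm (p :: S') ∨ S'.Perm (p :: S)) (t : ℕ) :
    WeightedHolderDominated r' (budgetWeight r P.B) (fun h => budgetWeight r (P.budget p t h))
      (P.transcript Q S t) (P.transcript Q S' t) := by
  have hr' := hr.symm.pos
  induction t with
  | zero =>
    have h := (HolderDominated.refl hr
      (Measure.dirac (Fin.elim0 : Fin 0 → Round X c))).weighted_const (budgetWeight r P.B)
    rw [mul_one] at h
    exact h
  | succ t ih =>
    rw [transcript_succ, transcript_succ]
    refine ih.bind hr' (measurable_roundStep hkappa Q hQ S' t) fun h => ?_
    -- The query law does not depend on the dataset, so the weight passes through unchanged.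
    have hquery := (HolderDominated.refl hr (Q t h)).weighted_const
      (budgetWeight r (P.budget p t h))
    rw [mul_one] at hquery
    have hcm := (measurable_countStep hkappa S' t).comp (measurable_prodMk_left (x := h))
    unfold roundStep
    refine hquery.bind hr' hcm fun q => ?_
    have hcount := (holderDominated_countLaw hr hsigma1 hp h q).weighted_const
      (budgetWeight r (P.midBudget h q p))
    -- The middle budget plus the price of the count is the budget at the start of the round.
    rw [budgetWeight_mul, midBudget, sub_add_cancel] at hcount
    have hlm := (measurable_labelStep hkappa S' t).comp (measurable_prodMk_left (x := (h, q)))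
    unfold countStep
    refine hcount.bind hr' hlm fun K => ?_
    have hlabel := (holderDominated_labelLaw hnonneg hr hsigma2 hfloor hp h q K).weighted_const
      (budgetWeight r (P.midBudget h q p -
        P.voteTerm h q K p p.2 ^ 2 / (2 * P.sigma2 ^ 2 * P.clamp K)))
    rw [budgetWeight_mul, sub_add_cancel] at hlabel
    exact hlabel.map (measurable_snoc_round h q K) fun a => by rw [budget_snoc hsigma2]

lemma holderDominated_transcript (hkappa : ∀ x, Measurable (P.kappa x))
    (hnonneg : ∀ x q, P.tau ≤ P.kappa x q → 0 ≤ P.kappa x q)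
    (hsigma1 : 0 < P.sigma1) (hsigma2 : 0 < P.sigma2) (hB : 0 ≤ P.B) (hfloor : 0 ≤ P.floor)
    (Q : (t : ℕ) → Kernel (Fin t → Round X c) X) (hQ : ∀ t, IsMarkovKernel (Q t))
    {S S' : List (X × Fin c)} (hS : Neighbouring S S') (t : ℕ) (hr : 1 < r) :
    HolderDominated r.conjExponent (budgetWeight r P.B) (P.transcript Q S t)
      (P.transcript Q S' t) := by
  obtain ⟨p, hp⟩ := hS.exists_perm
  exact (weightedHolderDominated_transcript hkappa hnonneg hsigma1 hsigma2 hfloor Q hQ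
    (Real.HolderConjugate.conjExponent hr) hp t).holderDominated fun h =>
      one_le_budgetWeight hr (budget_nonneg hnonneg hsigma2 hB hfloor p t h)

end IndKNN

theorem theorem3p1 {X : Type*} [MeasurableSpace X] {c : ℕ} [NeZero c] (P : IndKNN X)
    (hkappa : ∀ x, Measurable (P.kappa x))
    (hnonneg : ∀ x q, P.tau ≤ P.kappa x q → 0 ≤ P.kappa x q)
    (hsigma1 : 0 < P.sigma1) (hsigma2 : 0 < P.sigma2) (hB : 0 ≤ P.B) (hfloor : 0 ≤ P.floor)
    (Q : (t : ℕ) → Kernel (Fin t → Round X c) X) (hQ : ∀ t, IsMarkovKernel (Q t))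
    (T : ℕ) (α : ℝ) (hα : 1 ≤ α) :
    IsRDP α (P.B * α) (fun S : List (X × Fin c) => P.transcript Q S T) ∧
      IsRDP α (P.B * α) (fun S : List (X × Fin c) => P.output Q T S) := by
  have hprob := fun S => IndKNN.isProbabilityMeasure_transcript hkappa Q hQ S T
  have hlabels : Measurable fun (h : Fin T → Round X c) t => (h t).2.2 :=
    measurable_pi_iff.2 fun t => (measurable_pi_apply t).snd.snd
  have hout : ∀ S, IsProbabilityMeasure (P.output Q T S) := fun S =>
    Measure.isProbabilityMeasure_map hlabels.aemeasurable
  refine ⟨⟨hprob, fun S S' hS => ?_⟩, ⟨hout, fun S S' hS => ?_⟩⟩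
  · exact renyiDiv_le_of_holderDominated hB (fun p hp =>
      IndKNN.holderDominated_transcript hkappa hnonneg hsigma1 hsigma2 hB hfloor Q hQ hS T hp) hα
  · exact renyiDiv_le_of_holderDominated (μ := P.output Q T S) (ν := P.output Q T S') hB
      (fun p hp =>
      (IndKNN.holderDominated_transcript hkappa hnonneg hsigma1 hsigma2 hB hfloor Q hQ hS T hp).map
        hlabels) hα
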